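/- Let $(X,\mu)$ be a standard Borel probability space, let $d\ge 1$, and let $T_1,\dots,T_d$ be commuting measure preserving transformations of $(X,\mu)$. For a measure preserving transformation $S$ of a standard Borel probability space $(Y,\nu)$, let $\mathcal I(S)$ be the $\sigma$-algebra of measurable $S$-invariant sets, and let $\nu\times_{\mathcal I(S)}\nu$ be the probability measure on $Y\times Y$ characterized by $$\int f(y)f'(y')\,d(\nu\times_{\mathcal I(S)}\nu)(y,y')=\int \mathbb E_\nu(f\mid\mathcal I(S))\,\mathbb E_\nu(f'\mid\mathcal I(S))\,d\nu$$ for all bounded measurable $f,f'$ on $Y$. Define probability measures $\mu_k$ on $X^{2^k}$, whose points are written $x=(x_\epsilon\colon\epsilon\in\{0,1\}^k)$, by $\mu_0=\mu$ and $$\mu_{k+1}=\mu_k\times_{\mathcal I(T_{k+1}\times\dots\times T_{k+1})}\mu_k\qquad(0\le k<d),$$ where $(x',x'')\in X^{2^k}\times X^{2^k}$ is identified with the point $x\in X^{2^{k+1}}$ such that $x_{\eta0}=x'_\eta$ and $x_{\eta1}=x''_\eta$ for $\eta\in\{0,1\}^k$. Let $\mu^*=\mu_d$ on $X^*=X^{2^d}$,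 and define the box seminorm of a real-valued $f\in L^\infty(\mu)$ by $$|||f|||=\Bigl(\int\prod_{\epsilon\in\{0,1\}^d}f(x_\epsilon)\,d\mu^*(x)\Bigr)^{1/2^d}.$$ Write $\emptyset=00\cdots0\in\{0,1\}^d$, and write each $x\in X^*$ as $x=(x_\emptyset,x^\sharp)$ with $x^\sharp=(x_\epsilon\colon\epsilon\ne\emptyset)\in X^\sharp=X^{2^d-1}$. Let $\mathcal Z$ be the $\sigma$-algebra on $X$ consisting of the measurable sets $B\subset X$ for which there is a measurable set $A\subset X^\sharp$ such that $$\mathbf 1_B(x_\emptyset)=\mathbf 1_A(x^\sharp)\quad\text{for }\mu^*\text{-almost every }x=(x_\emptyset,x^\sharp)\in X^*.$$ Then $\mathcal Z$ is a characteristic $\sigma$-algebra for the box seminorm, in the following sense: for every $f\in L^\infty(\mu)$, $$|||f|||=0\quad\text{if and only if}\quad \mathbb E_\mu(f\mid\mathcal Z)=0 .$$ -/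

import Mathlib

open MeasureTheory ProbabilityTheory
open scoped ENNReal

namespace BoxSeminorm

/-- The conditionally independent square `ν ×_{I(S)} ν` on `Y × Y`, where `I(S)` is the σ-algebra of
`S`-invariant measurable sets: `∫ κ_y × κ_y dν(y)`, with `κ` the regular conditional probability of
`ν` given `I(S)`. The characterizing integral formula is `integral_condIndepSquare` below. -/
noncomputable def condIndepSquare {Y : Type*} [MeasurableSpace Y] [StandardBorelSpace Y]
    (ν : Measure Y) [IsFiniteMeasure ν] (S : Y → Y) : Measure (Y × Y) :=
  ν.bind fun y =>
    (condExpKernel ν (MeasurableSpace.invariants S) y).prod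
      (condExpKernel ν (MeasurableSpace.invariants S) y)

section

variable {Y : Type*} [MeasurableSpace Y] [StandardBorelSpace Y]

theorem measurable_condIndepSquare_aux (ν : Measure Y) [IsFiniteMeasure ν] (S : Y → Y) :
    Measurable fun y =>
      (condExpKernel ν (MeasurableSpace.invariants S) y).prod
        (condExpKernel ν (MeasurableSpace.invariants S) y) := by
  have h := (condExpKernel ν (MeasurableSpace.invariants S) ×ₖ
    condExpKernel ν (MeasurableSpace.invariants S)).measurable
  have h' := h.mono (MeasurableSpace.invariants_le S) le_rfl
  convert h' using 2 with y
  rw [Kernel.prod_apply]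

instance isProbabilityMeasure_condIndepSquare (ν : Measure Y) [IsProbabilityMeasure ν]
    (S : Y → Y) : IsProbabilityMeasure (condIndepSquare ν S) :=
  isProbabilityMeasure_bind (measurable_condIndepSquare_aux ν S).aemeasurable
    (Filter.Eventually.of_forall fun _ => inferInstance)

theorem integral_condIndepSquare (ν : Measure Y) [IsProbabilityMeasure ν] (S : Y → Y)
    {f g : Y → ℝ} (hf : Measurable f) (hg : Measurable g) {C D : ℝ}
    (hfC : ∀ y, |f y| ≤ C) (hgD : ∀ y, |g y| ≤ D) :
    ∫ p, f p.1 * g p.2 ∂(condIndepSquare ν S) =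
      ∫ y, (ν[f | MeasurableSpace.invariants S]) y *
        (ν[g | MeasurableSpace.invariants S]) y ∂ν := by
  have hle := MeasurableSpace.invariants_le S
  have hfi : Integrable f ν :=
    .of_bound hf.aestronglyMeasurable C (.of_forall fun y => by simpa using hfC y)
  have hgi : Integrable g ν :=
    .of_bound hg.aestronglyMeasurable D (.of_forall fun y => by simpa using hgD y)
  have hC : Integrable (fun p : Y × Y => f p.1 * g p.2) (condIndepSquare ν S) := by
    refine .of_bound (by fun_prop) (C * D) (.of_forall fun p => ?_)
    rw [norm_mul]
    exact mul_le_mul (hfC _) (hgD _) (norm_nonneg _) ((abs_nonneg _).trans (hfC p.1))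
  have h1 : ∫ p, f p.1 * g p.2 ∂(condIndepSquare ν S) =
      ∫ y, ∫ p, f p.1 * g p.2 ∂((condExpKernel ν (MeasurableSpace.invariants S) y).prod
        (condExpKernel ν (MeasurableSpace.invariants S) y)) ∂ν :=
    Kernel.integral_comp (κ := Kernel.const Unit ν) (a := ())
      (η := (⟨_, measurable_condIndepSquare_aux ν S⟩ : Kernel Y (Y × Y))) hC
  rw [h1]
  refine integral_congr_ae ?_
  filter_upwards [condExp_ae_eq_integral_condExpKernel hle hfi,
    condExp_ae_eq_integral_condExpKernel hle hgi] with y h2 h3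
  rw [h2, h3]
  exact integral_prod_mul _ _

end

/-- The identification of `X^{2^k} × X^{2^k}` with `X^{2^{k+1}}`: the pair `(x', x'')` is the point
`x` with `x_{η0} = x'_η` and `x_{η1} = x''_η`. -/
def glue {X : Type*} {k : ℕ} (p : ((Fin k → Bool) → X) × ((Fin k → Bool) → X)) :
    (Fin (k + 1) → Bool) → X :=
  fun ε => if ε (Fin.last k) then p.2 (Fin.init ε) else p.1 (Fin.init ε)

theorem measurable_glue {X : Type*} [MeasurableSpace X] {k : ℕ} :
    Measurable (glue : ((Fin k → Bool) → X) × ((Fin k → Bool) → X) → _) := by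
  refine measurable_pi_lambda _ fun ε => ?_
  unfold glue
  split_ifs <;> fun_prop

/-- The diagonal transformation `S × ⋯ × S` of `X^{2^k}`. -/
def diag {X : Type*} (k : ℕ) (S : X → X) (x : (Fin k → Bool) → X) : (Fin k → Bool) → X :=
  fun ε => S (x ε)

section

variable {X : Type*} [MeasurableSpace X] [StandardBorelSpace X]

/-- The measures `μ_{T_1,…,T_k}` on `X^{2^k}` (bundled as probability measures), starting from `μ`
on `X = X^{2^0}`, with
`μ_{T_1,…,T_{k+1}} = μ_{T_1,…,T_k} ×_{I(T_{k+1} × ⋯ × T_{k+1})} μ_{T_1,…,T_k}`. -/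
noncomputable def boxProbabilityMeasure (μ : Measure X) [IsProbabilityMeasure μ] :
    (k : ℕ) → (Fin k → X → X) → ProbabilityMeasure ((Fin k → Bool) → X)
  | 0, _ => ⟨μ.map fun x _ => x,
      Measure.isProbabilityMeasure_map
        (measurable_pi_lambda _ fun _ => measurable_id).aemeasurable⟩
  | k + 1, T =>
    ⟨(condIndepSquare
        (boxProbabilityMeasure μ k fun i => T i.castSucc : Measure ((Fin k → Bool) → X))
        (diag k (T (Fin.last k)))).map glue,
      Measure.isProbabilityMeasure_map measurable_glue.aemeasurable⟩

/-- The box measure `μ^* = μ_{T_1,…,T_d}` on `X^* = X^{2^d}`. -/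
noncomputable def boxMeasure (μ : Measure X) [IsProbabilityMeasure μ] {d : ℕ} (T : Fin d → X → X) :
    Measure ((Fin d → Bool) → X) :=
  (boxProbabilityMeasure μ d T : Measure ((Fin d → Bool) → X))

/-- The box seminorm `|||f|||` associated to `T_1,…,T_d`. -/
noncomputable def boxSeminorm (μ : Measure X) [IsProbabilityMeasure μ] {d : ℕ} (T : Fin d → X → X)
    (f : X → ℝ) : ℝ :=
  (∫ x, ∏ ε : Fin d → Bool, f (x ε) ∂(boxMeasure μ T)) ^ ((1 : ℝ) / 2 ^ d)

/-- The index `∅ = 00…0`. -/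
def zeroIndex (d : ℕ) : Fin d → Bool := fun _ => false

/-- `X^♯ = X^{2^d - 1}`, with coordinates indexed by `ε ≠ ∅`. -/
abbrev Sharp (d : ℕ) (X : Type*) : Type _ := {ε : Fin d → Bool // ε ≠ zeroIndex d} → X

/-- The projection `x ↦ x^♯`. -/
def sharp {d : ℕ} {X : Type*} (x : (Fin d → Bool) → X) : Sharp d X := fun ε => x ε.1

/-- `1_B(x_∅) = 1_A(x^♯)` for `μ^*`-almost every `x`. -/
def AgreesWith (μ : Measure X) [IsProbabilityMeasure μ] {d : ℕ} (T : Fin d → X → X)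
    (B : Set X) (A : Set (Sharp d X)) : Prop :=
  ∀ᵐ x ∂(boxMeasure μ T),
    B.indicator (1 : X → ℝ) (x (zeroIndex d)) = A.indicator (1 : Sharp d X → ℝ) (sharp x)

theorem agreesWith_iff (μ : Measure X) [IsProbabilityMeasure μ] {d : ℕ} (T : Fin d → X → X)
    (B : Set X) (A : Set (Sharp d X)) :
    AgreesWith μ T B A ↔ ∀ᵐ x ∂(boxMeasure μ T), x (zeroIndex d) ∈ B ↔ sharp x ∈ A := by
  classical
  refine Filter.eventually_congr (.of_forall fun x => ?_)
  by_cases h1 : x (zeroIndex d) ∈ B <;> by_cases h2 : sharp x ∈ A <;> simp [h1, h2]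

/-- The σ-algebra `Z` on `X` of the measurable sets `B` such that `1_B(x_∅)` agrees
`μ^*`-almost everywhere with `1_A(x^♯)` for some measurable `A ⊆ X^♯`. -/
def sigmaZ (μ : Measure X) [IsProbabilityMeasure μ] {d : ℕ} (T : Fin d → X → X) :
    MeasurableSpace X where
  MeasurableSet' B := MeasurableSet B ∧ ∃ A : Set (Sharp d X), MeasurableSet A ∧ AgreesWith μ T B A
  measurableSet_empty := ⟨.empty, ∅, .empty, by simp [AgreesWith]⟩
  measurableSet_compl := by
    rintro B ⟨hB, A, hA, h⟩
    refine ⟨hB.compl, Aᶜ, hA.compl, ?_⟩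
    rw [agreesWith_iff] at h ⊢
    filter_upwards [h] with x hx
    exact not_congr hx
  measurableSet_iUnion := by
    intro B hB
    choose hm A hA h using hB
    refine ⟨.iUnion hm, ⋃ i, A i, .iUnion hA, ?_⟩
    simp only [agreesWith_iff] at h ⊢
    filter_upwards [ae_all_iff.2 h] with x hx
    simp [hx]

end

end BoxSeminorm

/-! By Gowers–Cauchy–Schwarz (`integral_prod_pow_le`), `|||f||| = 0` forces the integral of `f(x_∅)`
against any product of bounded functions of the other coordinates to vanish. Such products determine
conditional expectations, so `|||f||| = 0` exactly when `f(x_∅)` is orthogonal to every bounded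
function of `x^♯` (`integral_prod_eq_zero_iff_forall_sharp`). A set of `Z` can be read off from
`x_∅` or from `x^♯`, so this orthogonality gives `E(f | Z) = 0` at once.

For the converse, let `Φ(x^♯)` be the conditional expectation of `f(x_∅)` given `x^♯`. The side
transformations preserve `μ^*` and fix `x_∅`, so `Φ` is invariant under them. A function invariant
under all of them depends only on `x_∅` (`exists_eq_zeroIndex_of_side_invariant`), so `Φ(x^♯) =
G(x_∅)`, and `G` is `Z`-measurable by the very definition of `Z`. Hence `∫ Φ² = ∫ f G dμ = ∫ E(f |
Z) G dμ = 0`.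

Both tools are inductions on the dimension, one square `ν ×_{I(S)} ν` at a time. The inductive step
of the second is `exists_eq_fst_of_invariant`. For the first, the mean ergodic theorem exhibits the
square as the limit of averages of the joint laws of `(S^n y, y)`; commutativity of the `T_i` enters
through the same limit. -/

namespace BoxSeminorm

open Filter Topology

/-! ### Bounded measurable functions -/

/-- A bounded measurable real function. -/
structure BddMeas {Ω : Type*} [MeasurableSpace Ω] (f : Ω → ℝ) : Prop where
  measurable : Measurable f
  bound : ∃ C, ∀ x, |f x| ≤ C

namespace BddMeas

variable {Ω Ω' : Type*} [MeasurableSpace Ω] [MeasurableSpace Ω'] {f g : Ω → ℝ}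

theorem integrable (hf : BddMeas f) (P : Measure Ω) [IsFiniteMeasure P] : Integrable f P := by
  obtain ⟨C, hC⟩ := hf.bound
  exact .of_bound hf.measurable.aestronglyMeasurable C (.of_forall hC)

theorem memLp (hf : BddMeas f) (P : Measure Ω) [IsFiniteMeasure P] (p : ℝ≥0∞) : MemLp f p P := by
  obtain ⟨C, hC⟩ := hf.bound
  exact .of_bound hf.measurable.aestronglyMeasurable C (.of_forall hC)

theorem mul (hf : BddMeas f) (hg : BddMeas g) : BddMeas fun x => f x * g x := by
  obtain ⟨C, hC⟩ := hf.bound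
  obtain ⟨D, hD⟩ := hg.bound
  refine ⟨hf.measurable.mul hg.measurable, C * D, fun x => ?_⟩
  rw [abs_mul]
  exact mul_le_mul (hC x) (hD x) (abs_nonneg _) ((abs_nonneg _).trans (hC x))

theorem sub (hf : BddMeas f) (hg : BddMeas g) : BddMeas fun x => f x - g x := by
  obtain ⟨C, hC⟩ := hf.bound
  obtain ⟨D, hD⟩ := hg.bound
  exact ⟨hf.measurable.sub hg.measurable, C + D, fun x =>
    (abs_sub _ _).trans (add_le_add (hC x) (hD x))⟩

theorem comp (hf : BddMeas f) {φ : Ω' → Ω} (hφ : Measurable φ) : BddMeas fun x => f (φ x) :=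
  ⟨hf.measurable.comp hφ, hf.bound.imp fun _ h x => h (φ x)⟩

theorem const (c : ℝ) : BddMeas fun _ : Ω => c := ⟨measurable_const, |c|, fun _ => le_rfl⟩

theorem prod {ι : Type*} (s : Finset ι) {f : ι → Ω → ℝ} (hf : ∀ i ∈ s, BddMeas (f i)) :
    BddMeas fun x => ∏ i ∈ s, f i x := by
  classical
  induction s using Finset.induction_on with
  | empty => simpa using const 1
  | insert a s ha ih =>
    simp only [Finset.prod_insert ha]
    exact (hf a (by simp)).mul (ih fun i hi => hf i (by simp [hi]))

theorem indicator_one {s : Set Ω} (hs : MeasurableSet s) : BddMeas (s.indicator (1 : Ω → ℝ)) := by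
  refine ⟨measurable_one.indicator hs, 1, fun x => ?_⟩
  by_cases h : x ∈ s <;> simp [h]

theorem clamp {w : Ω → ℝ} (hw : Measurable w) (C : ℝ) :
    BddMeas fun x => max (-C) (min C (w x)) := by
  refine ⟨measurable_const.max (measurable_const.min hw), |C|, fun x => ?_⟩
  rcases le_total 0 C with h | h
  · rw [abs_of_nonneg h, abs_le]
    exact ⟨le_max_left _ _, max_le (by linarith) (min_le_left _ _)⟩
  -- For `C ≤ 0` the clamped function is the constant `-C`, so no sign condition is needed.
  · rw [max_eq_left ((min_le_left _ _).trans (by linarith)), abs_neg]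

end BddMeas

theorem clamp_eq_self {a C : ℝ} (h : |a| ≤ C) : max (-C) (min C a) = a := by
  rw [min_eq_right (abs_le.1 h).2, max_eq_right (abs_le.1 h).1]

theorem BddMeas.condExp_version {Ω : Type*} {m m0 : MeasurableSpace Ω} (hm : m ≤ m0)
    {f : Ω → ℝ} (hf : BddMeas f)
    (P : Measure Ω) [IsFiniteMeasure P] :
    ∃ g : Ω → ℝ, Measurable[m] g ∧ BddMeas g ∧ g =ᵐ[P] P[f | m] := by
  obtain ⟨C, hC⟩ := hf.bound
  have hmeas : Measurable[m] fun x => max (-C) (min C ((P[f | m]) x)) :=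
    measurable_const.max (measurable_const.min stronglyMeasurable_condExp.measurable)
  refine ⟨_, hmeas, .clamp (stronglyMeasurable_condExp.mono hm).measurable C, ?_⟩
  filter_upwards [ae_bdd_abs_condExp_of_ae_bdd_abs (m := m) (μ := P) (f := f) (R := C)
    (.of_forall hC)] with x hx
  exact clamp_eq_self hx

theorem integral_condExp_mul {Y : Type*} {m m0 : MeasurableSpace Y} (hm : m ≤ m0) {ν : Measure[m0] Y}
    [IsProbabilityMeasure ν] {f w : Y → ℝ} (hf : Integrable f ν)
    (hw : AEStronglyMeasurable[m] w ν) (hfw : Integrable (fun y => f y * w y) ν) :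
    ∫ y, (ν[f | m]) y * w y ∂ν = ∫ y, f y * w y ∂ν := by
  have h := condExp_mul_of_aestronglyMeasurable_right hw hfw hf
  rw [← integral_condExp hm (f := fun y => f y * w y)]
  exact integral_congr_ae h.symm

theorem BddMeas.integral_comp {Ω Ω' : Type*} [MeasurableSpace Ω] [MeasurableSpace Ω']
    {P : Measure Ω} {Q : Measure Ω'} {φ : Ω → Ω'} (hφ : MeasurePreserving φ P Q) {f : Ω' → ℝ}
    (hf : BddMeas f) : ∫ x, f (φ x) ∂P = ∫ y, f y ∂Q := by
  rw [← hφ.map_eq, integral_map hφ.aemeasurable hf.measurable.aestronglyMeasurable]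

/-! ### Invariant functions and the mean ergodic theorem -/

section Invariant

variable {Y : Type*} [MeasurableSpace Y] {ν : Measure Y} {S : Y → Y}

/-- An almost everywhere invariant function agrees almost everywhere with an invariant one. -/
theorem aestronglyMeasurable_invariants (hS : MeasurePreserving S ν ν) {w : Y → ℝ}
    (hw : Measurable w) (hinv : (fun y => w (S y)) =ᵐ[ν] w) :
    AEStronglyMeasurable[MeasurableSpace.invariants S] w ν := by
  -- The limsup along the orbit does not see the first term, so it is invariant at every point, even
  -- where the orbit is unbounded and the limsup takes a default value.
  have hlim : Measurable fun y => limsup (fun n => w (S^[n] y)) atTop :=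
    Measurable.limsup fun n => hw.comp (hS.measurable.iterate n)
  refine ⟨fun y => limsup (fun n => w (S^[n] y)) atTop, ?_, ?_⟩
  · refine Measurable.stronglyMeasurable ?_
    rw [MeasurableSpace.measurable_invariants_dom]
    refine ⟨hlim, fun s _ => ?_⟩
    congr 1
    funext y
    exact limsup_nat_add (fun n => w (S^[n] y)) 1
  · have h : ∀ n : ℕ, ∀ᵐ y ∂ν, w (S^[n] y) = w y := by
      intro n
      induction n with
      | zero => simp
      | succ n ih =>
        filter_upwards [hS.quasiMeasurePreserving.ae ih, hinv] with y h1 h2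
        rw [Function.iterate_succ_apply, h1, h2]
    filter_upwards [ae_all_iff.2 h] with y hy
    simp [hy]

/-- A function whose correlations are unchanged by `S` is invariant under `S`. -/
theorem ae_invariant_of_integral_comp [IsProbabilityMeasure ν]
    (hS : MeasurePreserving S ν ν) {w : Y → ℝ} (hw : BddMeas w)
    (h : ∀ g : Y → ℝ, BddMeas g → ∫ y, w y * g (S y) ∂ν = ∫ y, w y * g y ∂ν) :
    (fun y => w (S y)) =ᵐ[ν] w := by
  have hwS := hw.comp hS.measurable
  -- Expand `‖w ∘ S - w‖²`: both squares equal `‖w‖²`, and `h` with `g = w` makes the cross term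
  -- equal to `‖w‖²` too.
  have h1 : ∫ y, (w (S y) - w y) * (w (S y) - w y) ∂ν = 0 := by
    have h2 : ∫ y, w (S y) * w (S y) ∂ν = ∫ y, w y * w y ∂ν :=
      (hw.mul hw).integral_comp hS
    have h3 : ∀ y, (w (S y) - w y) * (w (S y) - w y) =
        w (S y) * w (S y) - w y * w (S y) - (w y * w (S y) - w y * w y) := fun y => by ring
    simp_rw [h3]
    rw [integral_sub, integral_sub, integral_sub, h w hw, h2]
    · ring
    all_goals
      first
      | exact ((hw.mul hwS).integrable ν)
      | exact ((hw.mul hw).integrable ν)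
      | exact ((hwS.mul hwS).integrable ν)
      | exact (((hwS.mul hwS).sub (hw.mul hwS)).integrable ν)
      | exact (((hw.mul hwS).sub (hw.mul hw)).integrable ν)
  rw [integral_eq_zero_iff_of_nonneg (fun y => mul_self_nonneg _)
    (((hwS.sub hw).mul (hwS.sub hw)).integrable ν)] at h1
  filter_upwards [h1] with y hy
  have := mul_self_eq_zero.1 hy
  linarith

/-- The mean ergodic theorem, in weak form. -/
theorem tendsto_average_integral [IsProbabilityMeasure ν]
    (hS : MeasurePreserving S ν ν) {f g : Y → ℝ} (hf : BddMeas f)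
    (hg : BddMeas g) :
    Tendsto (fun N : ℕ => (N : ℝ)⁻¹ * ∑ n ∈ Finset.range N, ∫ y, f (S^[n] y) * g y ∂ν) atTop
      (𝓝 (∫ y, (ν[f | MeasurableSpace.invariants S]) y * g y ∂ν)) := by
  let U : Lp ℝ 2 ν →ₗᵢ[ℝ] Lp ℝ 2 ν := Lp.compMeasurePreservingₗᵢ ℝ S hS
  have hU : ‖U.toContinuousLinearMap‖ ≤ 1 := U.norm_toContinuousLinearMap_le
  set fL : Lp ℝ 2 ν := (hf.memLp ν 2).toLp f with hfL
  set gL : Lp ℝ 2 ν := (hg.memLp ν 2).toLp g with hgL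
  have hlim := U.toContinuousLinearMap.tendsto_birkhoffAverage_orthogonalProjection hU fL
  set K := (U.toContinuousLinearMap).eqLocus (1 : Lp ℝ 2 ν →L[ℝ] Lp ℝ 2 ν) with hK
  set p : Lp ℝ 2 ν := (K.orthogonalProjectionOnto fL : Lp ℝ 2 ν) with hp
  have hpK : U p = p := (K.orthogonalProjectionOnto fL).2
  have hUf : ∀ n : ℕ, ((U.toContinuousLinearMap : Lp ℝ 2 ν → Lp ℝ 2 ν)^[n] fL : Y → ℝ)
      =ᵐ[ν] fun y => f (S^[n] y) := by
    intro n
    have h1 : (U.toContinuousLinearMap : Lp ℝ 2 ν → Lp ℝ 2 ν)^[n] =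
        Lp.compMeasurePreserving S^[n] (hS.iterate n) := Lp.compMeasurePreserving_iterate hS n
    rw [h1]
    filter_upwards [Lp.coeFn_compMeasurePreserving fL (hS.iterate n),
      (hS.iterate n).quasiMeasurePreserving.ae (hf.memLp ν 2).coeFn_toLp] with y h2 h3
    rw [h2, Function.comp_apply, hfL, h3]
  have hle := MeasurableSpace.invariants_le S
  have hpinv : AEStronglyMeasurable[MeasurableSpace.invariants S] (p : Y → ℝ) ν := by
    refine aestronglyMeasurable_invariants hS (Lp.stronglyMeasurable p).measurable ?_
    have := Lp.coeFn_compMeasurePreserving p hS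
    have h2 : Lp.compMeasurePreserving S hS p = p := hpK
    rw [h2] at this
    exact this.symm
  have hpi : Integrable p ν := (Lp.memLp p).integrable one_le_two
  -- The limit in von Neumann's theorem is the projection onto the fixed space of the Koopman
  -- operator. It is the conditional expectation because the fixed space contains the indicators of
  -- invariant sets.
  have hpc : (p : Y → ℝ) =ᵐ[ν] ν[f | MeasurableSpace.invariants S] := by
    refine ae_eq_condExp_of_forall_setIntegral_eq hle (hf.integrable ν)
      (fun s _ _ => hpi.integrableOn) (fun s hs _ => ?_) hpinv
    have hs0 := hle s hs
    let q : Lp ℝ 2 ν := indicatorConstLp 2 hs0 (measure_ne_top ν s) (1 : ℝ)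
    have hq : q ∈ K := by
      change Lp.compMeasurePreserving S hS q = q
      rw [Lp.indicatorConstLp_compMeasurePreserving]
      congr 1
      exact hs.2
    have h1 : inner ℝ q (fL - p) = 0 :=
      K.inner_right_of_mem_orthogonal hq (K.sub_starProjection_mem_orthogonal fL)
    rw [inner_sub_right, L2.inner_indicatorConstLp_one, L2.inner_indicatorConstLp_one] at h1
    rw [← sub_eq_zero.1 h1]
    exact setIntegral_congr_ae hs0 ((hf.memLp ν 2).coeFn_toLp.mono fun y hy _ => hy)
  have hinner := (hlim.inner (tendsto_const_nhds (x := gL)) (𝕜 := ℝ))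
  have e1 : inner ℝ p gL = ∫ y, (ν[f | MeasurableSpace.invariants S]) y * g y ∂ν := by
    rw [L2.inner_def]
    refine integral_congr_ae ?_
    filter_upwards [hpc, (hg.memLp ν 2).coeFn_toLp] with y h1 h2
    rw [h1, hgL, h2]
    simp [mul_comm]
  rw [← e1]
  refine hinner.congr fun N => ?_
  rw [birkhoffAverage, birkhoffSum, real_inner_smul_left, sum_inner]
  congr 1
  refine Finset.sum_congr rfl fun n _ => ?_
  rw [L2.inner_def]
  refine integral_congr_ae ?_
  filter_upwards [hUf n, (hg.memLp ν 2).coeFn_toLp] with y h1 h2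
  simp only [id]
  rw [h1, hgL, h2]
  simp [mul_comm]

/-- The conditional expectation of a bounded function given a factor map, as a function on the
factor. -/
theorem exists_factor_condExp {Ω : Type*} [MeasurableSpace Ω] (P : Measure Ω)
    [IsProbabilityMeasure P] {π : Ω → Y} (hπ : Measurable π) {F : Ω → ℝ} (hF : BddMeas F) :
    ∃ w : Y → ℝ, BddMeas w ∧ ∀ g : Y → ℝ, BddMeas g →
      ∫ x, F x * g (π x) ∂P = ∫ x, w (π x) * g (π x) ∂P := by
  obtain ⟨v, hv, hvb, hve⟩ := hF.condExp_version hπ.comap_le P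
  obtain ⟨w, hw, rfl⟩ := hv.exists_eq_measurable_comp
  obtain ⟨C, hC⟩ := hvb.bound
  -- The bound on `w` is known only on the range of `π`; clamping extends it to all of `Y` without
  -- changing `w ∘ π`.
  refine ⟨fun y => max (-C) (min C (w y)), .clamp hw C, fun g hg => ?_⟩
  rw [← integral_condExp_mul hπ.comap_le (hF.integrable P)
    (w := fun x => g (π x)) _ ((hF.mul (hg.comp hπ)).integrable P)]
  · refine integral_congr_ae ?_
    filter_upwards [hve] with x hx
    have h := clamp_eq_self (hC x)
    simp only [Function.comp_apply] at h hx
    rw [h, hx]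
  · exact (hg.measurable.comp (comap_measurable π)).stronglyMeasurable.aestronglyMeasurable

end Invariant

/-! ### Testing measures and functions on product sets -/

section Uniqueness

theorem setIntegral_eq_zero_of_generateFrom {Ω : Type*} [mΩ : MeasurableSpace Ω] {P : Measure Ω}
    {C : Set (Set Ω)} (hC : IsPiSystem C) (hgen : mΩ = MeasurableSpace.generateFrom C)
    {D : Ω → ℝ} (hD : Integrable D P) (huniv : ∫ x, D x ∂P = 0)
    (h : ∀ s ∈ C, ∫ x in s, D x ∂P = 0) {s : Set Ω} (hs : MeasurableSet s) :
    ∫ x in s, D x ∂P = 0 := by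
  induction s, hs using MeasurableSpace.induction_on_inter hgen hC with
  | empty => simp
  | basic t ht => exact h t ht
  | compl t ht ih =>
    have := integral_add_compl ht hD
    rw [ih, huniv, zero_add] at this
    exact this
  | iUnion f hd hf ih =>
    rw [integral_iUnion hf hd hD.integrableOn]
    simp [ih]

theorem integral_mul_indicator_one {Ω : Type*} [MeasurableSpace Ω] {P : Measure Ω} {D : Ω → ℝ}
    {s : Set Ω} (hs : MeasurableSet s) :
    ∫ x, D x * s.indicator (1 : Ω → ℝ) x ∂P = ∫ x in s, D x ∂P := by
  rw [← integral_indicator hs]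
  congr 1
  funext x
  by_cases h : x ∈ s <;> simp [h]

theorem indicator_prod_one {Y Y' : Type*} (s : Set Y) (t : Set Y') (p : Y × Y') :
    (s ×ˢ t).indicator (1 : Y × Y' → ℝ) p =
      s.indicator (1 : Y → ℝ) p.1 * t.indicator (1 : Y' → ℝ) p.2 := by
  by_cases h1 : p.1 ∈ s <;> by_cases h2 : p.2 ∈ t <;> simp [Set.indicator, Set.mem_prod, h1, h2]

variable {Y Y' : Type*} [MeasurableSpace Y] [MeasurableSpace Y']

theorem measure_prod_ext_of_integral {P Q : Measure (Y × Y')} [IsProbabilityMeasure P]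
    [IsProbabilityMeasure Q]
    (h : ∀ (f : Y → ℝ) (g : Y' → ℝ), BddMeas f → BddMeas g →
      ∫ p, f p.1 * g p.2 ∂P = ∫ p, f p.1 * g p.2 ∂Q) : P = Q := by
  refine Measure.ext_prod fun {s t} hs ht => ?_
  have := h _ _ (.indicator_one hs) (.indicator_one ht)
  simp_rw [← indicator_prod_one] at this
  rw [integral_indicator_one (hs.prod ht), integral_indicator_one (hs.prod ht)] at this
  exact (measureReal_eq_measureReal_iff).1 this

theorem ae_eq_zero_of_integral_prod {P : Measure (Y × Y')} [IsProbabilityMeasure P]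
    {D : Y × Y' → ℝ} (hD : BddMeas D)
    (h : ∀ (f : Y → ℝ) (g : Y' → ℝ), BddMeas f → BddMeas g →
      ∫ p, D p * (f p.1 * g p.2) ∂P = 0) : D =ᵐ[P] 0 := by
  refine ae_eq_zero_of_forall_setIntegral_eq_of_sigmaFinite
    (fun s _ _ => (hD.integrable P).integrableOn) fun s hs _ => ?_
  refine setIntegral_eq_zero_of_generateFrom isPiSystem_prod generateFrom_prod.symm
    (hD.integrable P) ?_ ?_ hs
  · simpa using h _ _ (.const 1) (.const 1)
  · rintro _ ⟨s, hs, t, ht, rfl⟩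
    rw [← integral_mul_indicator_one (MeasurableSet.prod hs ht)]
    simp_rw [indicator_prod_one]
    exact h _ _ (.indicator_one hs) (.indicator_one ht)

theorem measurePreserving_of_integral {Ω Ω' : Type*} [MeasurableSpace Ω] [MeasurableSpace Ω']
    {P : Measure Ω} {Q : Measure Ω'} [IsProbabilityMeasure P] [IsProbabilityMeasure Q]
    {φ : Ω → Ω'} (hφ : Measurable φ)
    (h : ∀ f : Ω' → ℝ, BddMeas f → ∫ x, f (φ x) ∂P = ∫ y, f y ∂Q) : MeasurePreserving φ P Q := by
  refine ⟨hφ, Measure.ext fun s hs => ?_⟩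
  have := Measure.isProbabilityMeasure_map (μ := P) hφ.aemeasurable
  have h1 := h _ (.indicator_one hs)
  rw [← integral_map hφ.aemeasurable (BddMeas.indicator_one hs).measurable.aestronglyMeasurable,
    integral_indicator_one hs, integral_indicator_one hs] at h1
  exact (measureReal_eq_measureReal_iff).1 h1

theorem measurePreserving_of_integral_mul {Y : Type*} [MeasurableSpace Y]
    {Q : Measure (Y × Y)} [IsProbabilityMeasure Q]
    {φ : Y × Y → Y × Y} (hφ : Measurable φ)
    (h : ∀ f g : Y → ℝ, BddMeas f → BddMeas g →
      ∫ p, f (φ p).1 * g (φ p).2 ∂Q = ∫ p, f p.1 * g p.2 ∂Q) : MeasurePreserving φ Q Q := by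
  have := Measure.isProbabilityMeasure_map (μ := Q) hφ.aemeasurable
  refine ⟨hφ, measure_prod_ext_of_integral fun f g hf hg => ?_⟩
  rw [integral_map hφ.aemeasurable
    ((hf.comp measurable_fst).mul (hg.comp measurable_snd)).measurable.aestronglyMeasurable]
  exact h f g hf hg

/-- This holds at every point, since the chosen version is genuinely measurable for the invariant
σ-algebra. -/
theorem condExp_invariants_comp {Y : Type*} [MeasurableSpace Y] (ν : Measure Y)
    (S : Y → Y) (f : Y → ℝ) (y : Y) :
    (ν[f | MeasurableSpace.invariants S]) (S y) = (ν[f | MeasurableSpace.invariants S]) y :=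
  congrFun (MeasurableSpace.comp_eq_of_measurable_invariants
    (stronglyMeasurable_condExp (f := f) (m := MeasurableSpace.invariants S)
      (μ := ν)).measurable) y

end Uniqueness

/-! ### The conditionally independent square -/

section Square

variable {Y : Type*} [MeasurableSpace Y] [StandardBorelSpace Y] {ν : Measure Y}
  [IsProbabilityMeasure ν] {S : Y → Y}

/-- Conditional expectation is a self-adjoint projection, so one of the two can be dropped. This is
the form of the limit in the mean ergodic theorem. -/
theorem integral_condIndepSquare_eq_condExp_mul (ν : Measure Y) [IsProbabilityMeasure ν]
    (S : Y → Y) {f g : Y → ℝ} (hf : BddMeas f) (hg : BddMeas g) :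
    ∫ p, f p.1 * g p.2 ∂(condIndepSquare ν S) =
      ∫ y, (ν[f | MeasurableSpace.invariants S]) y * g y ∂ν := by
  obtain ⟨C, hC⟩ := hf.bound
  obtain ⟨D, hD⟩ := hg.bound
  have hle := MeasurableSpace.invariants_le S
  rw [integral_condIndepSquare ν S hf.measurable hg.measurable hC hD]
  obtain ⟨f', hf'm, hf', hfe⟩ := hf.condExp_version hle ν
  have h1 := integral_condExp_mul (w := f') hle (hg.integrable ν)
    hf'm.stronglyMeasurable.aestronglyMeasurable ((hg.mul hf').integrable ν)
  calc _ = ∫ y, (ν[g | MeasurableSpace.invariants S]) y * f' y ∂ν :=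
        integral_congr_ae (by filter_upwards [hfe] with y hy; rw [hy, mul_comm])
    _ = ∫ y, g y * f' y ∂ν := h1
    _ = _ := integral_congr_ae (by filter_upwards [hfe] with y hy; rw [hy, mul_comm])

theorem tendsto_average_condIndepSquare (hS : MeasurePreserving S ν ν) {f g : Y → ℝ}
    (hf : BddMeas f) (hg : BddMeas g) :
    Tendsto (fun N : ℕ => (N : ℝ)⁻¹ * ∑ n ∈ Finset.range N, ∫ y, f (S^[n] y) * g y ∂ν) atTop
      (𝓝 (∫ p, f p.1 * g p.2 ∂(condIndepSquare ν S))) := by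
  rw [integral_condIndepSquare_eq_condExp_mul ν S hf hg]
  exact tendsto_average_integral hS hf hg

theorem integral_condIndepSquare_swap (ν : Measure Y) [IsProbabilityMeasure ν]
    (S : Y → Y) {f g : Y → ℝ} (hf : BddMeas f) (hg : BddMeas g) :
    ∫ p, f p.1 * g p.2 ∂(condIndepSquare ν S) = ∫ p, g p.1 * f p.2 ∂(condIndepSquare ν S) := by
  obtain ⟨C, hC⟩ := hf.bound
  obtain ⟨D, hD⟩ := hg.bound
  rw [integral_condIndepSquare ν S hf.measurable hg.measurable hC hD,
    integral_condIndepSquare ν S hg.measurable hf.measurable hD hC]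
  simp_rw [mul_comm]

theorem integral_condIndepSquare_fst (ν : Measure Y) [IsProbabilityMeasure ν] (S : Y → Y)
    {f : Y → ℝ} (hf : BddMeas f) : ∫ p, f p.1 ∂(condIndepSquare ν S) = ∫ y, f y ∂ν := by
  have h := integral_condIndepSquare_eq_condExp_mul ν S hf (.const 1)
  simpa [integral_condExp (MeasurableSpace.invariants_le S)] using h

theorem integral_condIndepSquare_snd (ν : Measure Y) [IsProbabilityMeasure ν] (S : Y → Y)
    {f : Y → ℝ} (hf : BddMeas f) : ∫ p, f p.2 ∂(condIndepSquare ν S) = ∫ y, f y ∂ν := by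
  have h := integral_condIndepSquare_swap ν S hf (.const 1)
  simp only [mul_one, one_mul] at h
  rw [← h, integral_condIndepSquare_fst ν S hf]

theorem measurePreserving_fst (ν : Measure Y) [IsProbabilityMeasure ν] (S : Y → Y) :
    MeasurePreserving Prod.fst (condIndepSquare ν S) ν :=
  measurePreserving_of_integral measurable_fst fun _ => integral_condIndepSquare_fst ν S

theorem measurePreserving_snd (ν : Measure Y) [IsProbabilityMeasure ν] (S : Y → Y) :
    MeasurePreserving Prod.snd (condIndepSquare ν S) ν :=
  measurePreserving_of_integral measurable_snd fun _ => integral_condIndepSquare_snd ν S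

/-- Each term of the ergodic averages is unchanged by `R`, which preserves `ν` and commutes with
`S^n`; the invariance passes to the limit. -/
theorem measurePreserving_prodMap_self (hS : MeasurePreserving S ν ν) {R : Y → Y}
    (hR : MeasurePreserving R ν ν) (hRS : Function.Commute R S) :
    MeasurePreserving (Prod.map R R) (condIndepSquare ν S) (condIndepSquare ν S) := by
  refine measurePreserving_of_integral_mul (hR.measurable.prodMap hR.measurable)
    fun f g hf hg => ?_
  refine tendsto_nhds_unique (tendsto_average_condIndepSquare hS (hf.comp hR.measurable)
    (hg.comp hR.measurable)) ((tendsto_average_condIndepSquare hS hf hg).congr fun N => ?_)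
  congr 1
  refine Finset.sum_congr rfl fun n _ => ?_
  rw [← BddMeas.integral_comp hR ((hf.comp (hS.measurable.iterate n)).mul hg)]
  simp_rw [(hRS.iterate_right n).eq]

/-- The factor `E(f | I(S))` is `S`-invariant, so it pairs equally with `g` and `g ∘ S`. -/
theorem measurePreserving_prodMap_id (hS : MeasurePreserving S ν ν) :
    MeasurePreserving (Prod.map id S) (condIndepSquare ν S) (condIndepSquare ν S) := by
  refine measurePreserving_of_integral_mul (measurable_id.prodMap hS.measurable)
    fun f g hf hg => ?_
  have h1 := integral_condIndepSquare_eq_condExp_mul ν S hf (hg.comp hS.measurable)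
  refine h1.trans ?_
  rw [integral_condIndepSquare_eq_condExp_mul ν S hf hg]
  have hE := condExp_invariants_comp ν S f
  have hEm := (stronglyMeasurable_condExp (f := f) (m := MeasurableSpace.invariants S)
    (μ := ν)).mono (MeasurableSpace.invariants_le S)
  calc _ = ∫ y, (ν[f | MeasurableSpace.invariants S]) (S y) * g (S y) ∂ν := by simp_rw [hE]
    _ = ∫ y, (ν[f | MeasurableSpace.invariants S]) y * g y ∂(ν.map S) :=
      (integral_map hS.aemeasurable
        (hEm.measurable.mul hg.measurable).aestronglyMeasurable).symm
    _ = _ := by rw [hS.map_eq]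

/-- Invariant functions take the same value at both coordinates. -/
theorem ae_fst_eq_snd_of_invariant (ν : Measure Y) [IsProbabilityMeasure ν] (S : Y → Y)
    {h : Y → ℝ} (hm : Measurable[MeasurableSpace.invariants S] h) (hh : BddMeas h) :
    ∀ᵐ p ∂(condIndepSquare ν S), h p.1 = h p.2 := by
  have h12 : ∫ p, h p.1 * h p.2 ∂(condIndepSquare ν S) = ∫ y, h y * h y ∂ν := by
    rw [integral_condIndepSquare_eq_condExp_mul ν S hh hh,
      condExp_of_stronglyMeasurable (MeasurableSpace.invariants_le S) hm.stronglyMeasurable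
        (hh.integrable ν)]
  -- By `h12` the cross term equals `∫ h²`, so the `L²` distance of the two copies of `h` is zero.
  have h1 := hh.comp (measurable_fst (α := Y) (β := Y))
  have h2 := hh.comp (measurable_snd (α := Y) (β := Y))
  have key : ∫ p, (h p.1 - h p.2) * (h p.1 - h p.2) ∂(condIndepSquare ν S) = 0 := by
    have e : ∀ p : Y × Y, (h p.1 - h p.2) * (h p.1 - h p.2) =
        (h p.1 * h p.1 - h p.1 * h p.2) - (h p.1 * h p.2 - h p.2 * h p.2) := fun p => by ring
    simp_rw [e]
    rw [integral_sub (((h1.mul h1).sub (h1.mul h2)).integrable _)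
      (((h1.mul h2).sub (h2.mul h2)).integrable _),
      integral_sub ((h1.mul h1).integrable _) ((h1.mul h2).integrable _),
      integral_sub ((h1.mul h2).integrable _) ((h2.mul h2).integrable _), h12,
      integral_condIndepSquare_fst ν S (hh.mul hh), integral_condIndepSquare_snd ν S (hh.mul hh)]
    ring
  rw [integral_eq_zero_iff_of_nonneg (fun y => mul_self_nonneg _)
    (((h1.sub h2).mul (h1.sub h2)).integrable _)] at key
  filter_upwards [key] with p hp
  exact sub_eq_zero.1 (mul_self_eq_zero.1 hp)

/-- A bounded function on the square invariant under `id × S` depends only on the first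
coordinate. -/
theorem exists_eq_fst_of_invariant (hS : MeasurePreserving S ν ν) {F : Y × Y → ℝ}
    (hF : BddMeas F) (hinv : ∀ᵐ p ∂(condIndepSquare ν S), F (p.1, S p.2) = F p) :
    ∃ G : Y → ℝ, BddMeas G ∧ ∀ᵐ p ∂(condIndepSquare ν S), F p = G p.1 := by
  set Q := condIndepSquare ν S with hQ
  obtain ⟨G, hG, hFG⟩ := exists_factor_condExp Q (measurable_fst (α := Y) (β := Y)) hF
  refine ⟨G, hG, ?_⟩
  have hG1 := hG.comp (measurable_fst (α := Y) (β := Y))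
  have hD := hF.sub hG1
  set D : Y × Y → ℝ := fun p => F p - G p.1 with hDdef
  have hDinv : ∀ᵐ p ∂Q, D (p.1, S p.2) = D p := by
    filter_upwards [hinv] with p hp
    simp [hDdef, hp]
  have hD0 : ∀ g : Y → ℝ, BddMeas g → ∫ p, D p * g p.1 ∂Q = 0 := by
    intro g hg
    have hg1 := hg.comp (measurable_fst (α := Y) (β := Y))
    simp_rw [hDdef, sub_mul]
    rw [integral_sub ((hF.mul hg1).integrable Q) ((hG1.mul hg1).integrable Q), hFG g hg, sub_self]
  have hle := MeasurableSpace.invariants_le S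
  -- `G` represents the conditional expectation of `F` given the first coordinate. The remainder `D`
  -- is orthogonal to functions of that coordinate, and must be shown orthogonal to products `f(y)
  -- g(y')`.
  have hzero : D =ᵐ[Q] 0 := by
    refine ae_eq_zero_of_integral_prod hD fun f g hf hg => ?_
    have hf1 := hf.comp (measurable_fst (α := Y) (β := Y))
    have hDf := hD.mul hf1
    obtain ⟨w, hw, hwD⟩ := exists_factor_condExp Q (measurable_snd (α := Y) (β := Y)) hDf
    have hwν : ∀ g : Y → ℝ, BddMeas g → ∫ p, D p * f p.1 * g p.2 ∂Q = ∫ y, w y * g y ∂ν :=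
      fun g hg => (hwD g hg).trans (integral_condIndepSquare_snd ν S (hw.mul hg))
    -- `w` represents the conditional expectation of `D · f(y)` given `y'`; both this function and
    -- the measure are invariant under `id × S`, hence so is `w` under `S`.
    have hwinv : (fun y => w (S y)) =ᵐ[ν] w := by
      refine ae_invariant_of_integral_comp hS hw fun g hg => ?_
      have hgS := hg.comp hS.measurable
      rw [← hwν g hg, ← hwν _ hgS]
      have h1 := BddMeas.integral_comp (measurePreserving_prodMap_id hS)
        (hDf.mul (hg.comp (measurable_snd (α := Y) (β := Y))))
      refine Eq.trans (integral_congr_ae ?_) h1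
      filter_upwards [hDinv] with p hp
      simp only [Prod.map, id, hp]
    -- Against the invariant `w`, `g` may be replaced by `E(g | I(S))`. That function agrees at both
    -- coordinates, so it moves to the first one, where `D` is orthogonal to everything.
    obtain ⟨g', hg'm, hg', hge⟩ := hg.condExp_version hle ν
    calc ∫ p, D p * (f p.1 * g p.2) ∂Q = ∫ p, D p * f p.1 * g p.2 ∂Q := by simp_rw [mul_assoc]
      _ = ∫ y, g y * w y ∂ν := by rw [hwν g hg]; simp_rw [mul_comm]
      _ = ∫ y, (ν[g | MeasurableSpace.invariants S]) y * w y ∂ν :=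
        (integral_condExp_mul hle (hg.integrable ν)
          (aestronglyMeasurable_invariants hS hw.measurable hwinv)
          ((hg.mul hw).integrable ν)).symm
      _ = ∫ y, w y * g' y ∂ν :=
        integral_congr_ae (by filter_upwards [hge] with y hy; rw [hy, mul_comm])
      _ = ∫ p, D p * f p.1 * g' p.2 ∂Q := (hwν g' hg').symm
      _ = ∫ p, D p * (f p.1 * g' p.1) ∂Q := by
        refine integral_congr_ae ?_
        filter_upwards [ae_fst_eq_snd_of_invariant ν S hg'm hg'] with p hp
        rw [hp, mul_assoc]
      _ = 0 := hD0 _ (hf.mul hg')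
  filter_upwards [hzero] with p hp
  exact sub_eq_zero.1 hp

end Square

/-! ### Diagonal and side transformations of the cube -/

/-- The side transformation: `T i` acts on the coordinates `x_ε` with `ε i = 1`. -/
def side {X : Type*} {k : ℕ} (T : Fin k → X → X) (i : Fin k) (x : (Fin k → Bool) → X) :
    (Fin k → Bool) → X :=
  fun ε => if ε i then T i (x ε) else x ε

section Glue

variable {X : Type*} {k : ℕ}

theorem diag_glue (S : X → X) (p : ((Fin k → Bool) → X) × ((Fin k → Bool) → X)) :
    diag (k + 1) S (glue p) = glue (Prod.map (diag k S) (diag k S) p) := by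
  funext ε
  by_cases h : ε (Fin.last k) <;> simp [diag, glue, h]

theorem side_castSucc_glue (T : Fin (k + 1) → X → X) (i : Fin k)
    (p : ((Fin k → Bool) → X) × ((Fin k → Bool) → X)) :
    side T i.castSucc (glue p) =
      glue (Prod.map (side (fun j => T j.castSucc) i) (side (fun j => T j.castSucc) i) p) := by
  funext ε
  by_cases h : ε (Fin.last k) <;> by_cases h' : ε i.castSucc <;> simp [side, glue, Fin.init, h, h']

theorem side_last_glue (T : Fin (k + 1) → X → X)
    (p : ((Fin k → Bool) → X) × ((Fin k → Bool) → X)) :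
    side T (Fin.last k) (glue p) = glue (Prod.map id (diag k (T (Fin.last k))) p) := by
  funext ε
  by_cases h : ε (Fin.last k) <;> simp [side, glue, diag, h]

theorem diag_iterate (S : X → X) (n : ℕ) : (diag k S)^[n] = diag k S^[n] := by
  induction n with
  | zero => rfl
  | succ n ih => rw [Function.iterate_succ', ih, Function.iterate_succ']; rfl

theorem diag_commute {R S : X → X} (h : Function.Commute R S) :
    Function.Commute (diag k R) (diag k S) :=
  fun x => funext fun ε => h (x ε)

theorem side_commute_diag {T : Fin k → X → X} {S : X → X} (i : Fin k)
    (h : Function.Commute (T i) S) : Function.Commute (side T i) (diag k S) := by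
  intro x
  funext ε
  by_cases hε : ε i <;> simp [side, diag, hε, h.eq]

/-- Splitting a product over `{0,1}^{k+1}` according to the last coordinate. -/
theorem prod_glue (f : (Fin (k + 1) → Bool) → X → ℝ)
    (p : ((Fin k → Bool) → X) × ((Fin k → Bool) → X)) :
    ∏ ε, f ε (glue p ε) =
      (∏ η : Fin k → Bool, f (Fin.snoc η false) (p.1 η)) *
        ∏ η : Fin k → Bool, f (Fin.snoc η true) (p.2 η) := by
  rw [← (Fin.snocEquiv fun _ => Bool).prod_comp, Fintype.prod_prod_type, Fintype.prod_bool,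
    mul_comm]
  simp [glue, Fin.snocEquiv]

variable [MeasurableSpace X]

theorem measurable_diag {S : X → X} (hS : Measurable S) : Measurable (diag k S) :=
  measurable_pi_lambda _ fun ε => hS.comp (measurable_pi_apply ε)

theorem measurable_side {T : Fin k → X → X} {i : Fin k} (hT : Measurable (T i)) :
    Measurable (side T i) := by
  refine measurable_pi_lambda _ fun ε => ?_
  by_cases h : ε i
  · simpa [side, h, Function.comp_def] using hT.comp (measurable_pi_apply ε)
  · simpa [side, h] using measurable_pi_apply ε

theorem BddMeas.prod_apply {f : (Fin k → Bool) → X → ℝ} (hf : ∀ ε, BddMeas (f ε)) :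
    BddMeas fun x : (Fin k → Bool) → X => ∏ ε, f ε (x ε) :=
  .prod _ fun ε _ => (hf ε).comp (measurable_pi_apply ε)

end Glue

/-! ### The box measures and the Gowers–Cauchy–Schwarz inequality -/

section Box

variable {X : Type*} [MeasurableSpace X] [StandardBorelSpace X] (μ : Measure X)
  [IsProbabilityMeasure μ]

instance {k : ℕ} (T : Fin k → X → X) : IsProbabilityMeasure (boxMeasure μ T) :=
  (boxProbabilityMeasure μ k T).2

theorem measurePreserving_glue {k : ℕ} (T : Fin (k + 1) → X → X) :
    MeasurePreserving glue
      (condIndepSquare (boxMeasure μ fun i => T i.castSucc) (diag k (T (Fin.last k))))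
      (boxMeasure μ T) :=
  ⟨measurable_glue, rfl⟩

theorem measurePreserving_boxMeasure_of_glue {k : ℕ} (T : Fin (k + 1) → X → X)
    {φ : ((Fin (k + 1) → Bool) → X) → (Fin (k + 1) → Bool) → X} (hφ : Measurable φ)
    {ψ : ((Fin k → Bool) → X) × ((Fin k → Bool) → X) → _} (h : ∀ p, φ (glue p) = glue (ψ p))
    (hψ : MeasurePreserving ψ
      (condIndepSquare (boxMeasure μ fun i => T i.castSucc) (diag k (T (Fin.last k))))
      (condIndepSquare (boxMeasure μ fun i => T i.castSucc) (diag k (T (Fin.last k))))) :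
    MeasurePreserving φ (boxMeasure μ T) (boxMeasure μ T) := by
  refine ⟨hφ, ?_⟩
  have hg := measurePreserving_glue μ T
  conv_lhs => rw [← hg.map_eq, Measure.map_map hφ measurable_glue]
  have : φ ∘ glue = glue ∘ ψ := funext h
  rw [this]
  exact (hg.comp hψ).map_eq

theorem measurePreserving_apply {k : ℕ} (T : Fin k → X → X) (ε : Fin k → Bool) :
    MeasurePreserving (fun x => x ε) (boxMeasure μ T) μ := by
  induction k with
  | zero =>
    have h : MeasurePreserving (fun (x : X) (_ : Fin 0 → Bool) => x) μ (boxMeasure μ T) :=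
      ⟨measurable_pi_lambda _ fun _ => measurable_id, rfl⟩
    refine ⟨measurable_pi_apply ε, ?_⟩
    rw [← h.map_eq, Measure.map_map (measurable_pi_apply ε) h.measurable]
    exact Measure.map_id
  | succ k ih =>
    have hg := measurePreserving_glue μ T
    refine ⟨measurable_pi_apply ε, ?_⟩
    rw [← hg.map_eq, Measure.map_map (measurable_pi_apply ε) measurable_glue]
    by_cases h : ε (Fin.last k)
    · have e : (fun x : (Fin (k + 1) → Bool) → X => x ε) ∘ glue =
          (fun x => x (Fin.init ε)) ∘ Prod.snd := by
        funext p; simp [glue, h]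
      rw [e]
      exact ((ih _ _).comp (measurePreserving_snd _ _)).map_eq
    · have e : (fun x : (Fin (k + 1) → Bool) → X => x ε) ∘ glue =
          (fun x => x (Fin.init ε)) ∘ Prod.fst := by
        funext p; simp [glue, h]
      rw [e]
      exact ((ih _ _).comp (measurePreserving_fst _ _)).map_eq

variable {μ}

/-- The induction varies `S`: the step needs the previous level both for `S` and for the last `T`,
which defines the square. -/
theorem measurePreserving_diag {k : ℕ} {T : Fin k → X → X}
    (hT : ∀ i, MeasurePreserving (T i) μ μ) (hcomm : ∀ i j, Function.Commute (T i) (T j))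
    {S : X → X} (hS : MeasurePreserving S μ μ) (hST : ∀ i, Function.Commute S (T i)) :
    MeasurePreserving (diag k S) (boxMeasure μ T) (boxMeasure μ T) := by
  induction k generalizing S with
  | zero =>
    have h : MeasurePreserving (fun (x : X) (_ : Fin 0 → Bool) => x) μ (boxMeasure μ T) :=
      ⟨measurable_pi_lambda _ fun _ => measurable_id, rfl⟩
    refine ⟨measurable_diag hS.measurable, ?_⟩
    conv_lhs => rw [← h.map_eq, Measure.map_map (measurable_diag hS.measurable) h.measurable]
    exact (h.comp hS).map_eq
  | succ k ih =>
    have ih' := @ih (fun i => T i.castSucc) (fun i => hT _) (fun i j => hcomm _ _)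
    exact measurePreserving_boxMeasure_of_glue μ T (measurable_diag hS.measurable) (diag_glue S)
      (measurePreserving_prodMap_self (ih' (hT _) fun i => hcomm _ _)
        (ih' hS fun i => hST _) (diag_commute (hST _)))

theorem measurePreserving_diag_last {k : ℕ} {T : Fin (k + 1) → X → X}
    (hT : ∀ i, MeasurePreserving (T i) μ μ) (hcomm : ∀ i j, Function.Commute (T i) (T j)) :
    MeasurePreserving (diag k (T (Fin.last k))) (boxMeasure μ fun i => T i.castSucc)
      (boxMeasure μ fun i => T i.castSucc) :=
  measurePreserving_diag (fun _ => hT _) (fun _ _ => hcomm _ _) (hT _) fun _ => hcomm _ _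

/-- Seen on the square, the last side is `id × S`, and every other side is a side of the lower cube
acting on both halves. -/
theorem measurePreserving_side {k : ℕ} {T : Fin k → X → X}
    (hT : ∀ i, MeasurePreserving (T i) μ μ) (hcomm : ∀ i j, Function.Commute (T i) (T j))
    (i : Fin k) : MeasurePreserving (side T i) (boxMeasure μ T) (boxMeasure μ T) := by
  induction k with
  | zero => exact i.elim0
  | succ k ih =>
    have hS := measurePreserving_diag_last hT hcomm
    refine Fin.lastCases ?_ (fun i => ?_) i
    · exact measurePreserving_boxMeasure_of_glue μ T (measurable_side (hT _).measurable)
        (side_last_glue T) (measurePreserving_prodMap_id hS)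
    · exact measurePreserving_boxMeasure_of_glue μ T (measurable_side (hT _).measurable)
        (side_castSucc_glue T i) (measurePreserving_prodMap_self hS
          (@ih (fun i => T i.castSucc) (fun i => hT _) (fun i j => hcomm _ _) i)
          (side_commute_diag i (hcomm _ _)))

/-- A function invariant under all side transformations depends only on the coordinate `x_∅`. -/
theorem exists_eq_zeroIndex_of_side_invariant {k : ℕ} {T : Fin k → X → X}
    (hT : ∀ i, MeasurePreserving (T i) μ μ) (hcomm : ∀ i j, Function.Commute (T i) (T j))
    {F : ((Fin k → Bool) → X) → ℝ} (hF : BddMeas F)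
    (hinv : ∀ i, ∀ᵐ x ∂(boxMeasure μ T), F (side T i x) = F x) :
    ∃ G : X → ℝ, BddMeas G ∧ ∀ᵐ x ∂(boxMeasure μ T), F x = G (x (zeroIndex k)) := by
  induction k with
  | zero =>
    refine ⟨fun x => F fun _ => x, hF.comp (measurable_pi_lambda _ fun _ => measurable_id),
      .of_forall fun x => ?_⟩
    congr 1
    funext ε
    rw [Subsingleton.elim ε (zeroIndex 0)]
  | succ k ih =>
    have hS := measurePreserving_diag_last hT hcomm
    have hg := measurePreserving_glue μ T
    have hinv' := fun i => hg.quasiMeasurePreserving.ae (hinv i)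
    -- The last side removes the half of the coordinates with last index `1`; invariance under the
    -- other sides then descends to `G'` along the first projection.
    obtain ⟨G', hG', hFG'⟩ := exists_eq_fst_of_invariant hS (hF.comp measurable_glue) (by
      filter_upwards [hinv' (Fin.last k)] with p hp
      rw [side_last_glue] at hp
      exact hp)
    obtain ⟨G, hG, hGG⟩ := @ih (fun i => T i.castSucc) (fun i => hT _) (fun i j => hcomm _ _)
      G' hG' (by
        intro i
        have hmp := measurePreserving_prodMap_self hS
          (measurePreserving_side (fun i => hT (Fin.castSucc i)) (fun i j => hcomm _ _) i)
          (side_commute_diag i (hcomm _ _))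
        have h1 := measurePreserving_fst (boxMeasure μ fun i => T (Fin.castSucc i))
          (diag k (T (Fin.last k)))
        have hmeas : MeasurableSet {y | G' (side (fun i => T (Fin.castSucc i)) i y) = G' y} :=
          measurableSet_eq_fun
            (hG'.measurable.comp (measurable_side (hT (Fin.castSucc i)).measurable))
            hG'.measurable
        rw [← h1.map_eq, ae_map_iff h1.aemeasurable hmeas]
        filter_upwards [hinv' i.castSucc, hFG', hmp.quasiMeasurePreserving.ae hFG']
          with p h2 h3 h4
        rw [side_castSucc_glue] at h2
        rw [← h3, ← h2, h4]
        rfl)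
    refine ⟨G, hG, ?_⟩
    have hmeas : MeasurableSet {x : (Fin (k + 1) → Bool) → X | F x = G (x (zeroIndex (k + 1)))} :=
      measurableSet_eq_fun hF.measurable (hG.measurable.comp (measurable_pi_apply _))
    rw [← hg.map_eq, ae_map_iff hg.aemeasurable hmeas]
    filter_upwards [hFG', (measurePreserving_fst _ _).quasiMeasurePreserving.ae hGG] with p h1 h2
    rw [h1, h2]
    rfl

theorem integral_boxMeasure_succ {k : ℕ} (T : Fin (k + 1) → X → X)
    {f : (Fin (k + 1) → Bool) → X → ℝ} (hf : ∀ ε, BddMeas (f ε)) :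
    ∫ x, ∏ ε, f ε (x ε) ∂(boxMeasure μ T) =
      ∫ p, (∏ η : Fin k → Bool, f (Fin.snoc η false) (p.1 η)) *
        (∏ η : Fin k → Bool, f (Fin.snoc η true) (p.2 η))
        ∂(condIndepSquare (boxMeasure μ fun i => T i.castSucc) (diag k (T (Fin.last k)))) := by
  rw [← BddMeas.integral_comp (measurePreserving_glue μ T) (BddMeas.prod_apply hf)]
  simp_rw [prod_glue]

theorem integral_condIndepSquare_self_nonneg {Y : Type*} [MeasurableSpace Y]
    [StandardBorelSpace Y] (ν : Measure Y) [IsProbabilityMeasure ν] (S : Y → Y) {f : Y → ℝ}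
    (hf : BddMeas f) : 0 ≤ ∫ p, f p.1 * f p.2 ∂(condIndepSquare ν S) := by
  obtain ⟨C, hC⟩ := hf.bound
  rw [integral_condIndepSquare ν S hf.measurable hf.measurable hC hC]
  exact integral_nonneg fun y => mul_self_nonneg _

/-- Cauchy–Schwarz for the conditionally independent square. -/
theorem integral_condIndepSquare_sq_le {Y : Type*} [MeasurableSpace Y] [StandardBorelSpace Y]
    (ν : Measure Y) [IsProbabilityMeasure ν] (S : Y → Y) {f g : Y → ℝ} (hf : BddMeas f)
    (hg : BddMeas g) (hg1 : ∀ y, |g y| ≤ 1) :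
    (∫ p, f p.1 * g p.2 ∂(condIndepSquare ν S)) ^ 2 ≤
      ∫ p, f p.1 * f p.2 ∂(condIndepSquare ν S) := by
  set Q := condIndepSquare ν S with hQ
  set c := ∫ p, f p.1 * g p.2 ∂Q with hc
  have hprod : ∀ {u v : Y → ℝ}, BddMeas u → BddMeas v → BddMeas fun p : Y × Y => u p.1 * v p.2 :=
    fun hu hv => (hu.comp measurable_fst).mul (hv.comp measurable_snd)
  have hcg : BddMeas fun y => c * g y := (BddMeas.const c).mul hg
  have hgg : ∫ p, g p.1 * g p.2 ∂Q ≤ 1 := by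
    have h : ∫ p, g p.1 * g p.2 ∂Q ≤ ∫ _, (1 : ℝ) ∂Q :=
      integral_mono ((hprod hg hg).integrable Q) (integrable_const _) fun p => by
        have h : |g p.1 * g p.2| ≤ 1 := by
          rw [abs_mul]
          exact mul_le_one₀ (hg1 _) (abs_nonneg _) (hg1 _)
        exact (abs_le.1 h).2
    simpa using h
  have hgf : ∫ p, g p.1 * f p.2 ∂Q = c := (integral_condIndepSquare_swap ν S hf hg).symm
  -- Write `⟨u, v⟩` for the integral of `u ⊗ v`. With `c = ⟨f, g⟩`, positivity at `f - c g` reads `0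
  -- ≤ ⟨f, f⟩ - 2c² + c²⟨g, g⟩`, and `⟨g, g⟩ ≤ 1`.
  have h0 := integral_condIndepSquare_self_nonneg ν S (hf.sub hcg)
  have e : ∀ p : Y × Y, (f p.1 - c * g p.1) * (f p.2 - c * g p.2) =
      (f p.1 * f p.2 - c * (f p.1 * g p.2)) - (c * (g p.1 * f p.2) - c ^ 2 * (g p.1 * g p.2)) :=
    fun p => by ring
  have i1 := (hprod hf hf).integrable Q
  have i2 := ((hprod hf hg).integrable Q).const_mul c
  have i3 := ((hprod hg hf).integrable Q).const_mul c
  have i4 := ((hprod hg hg).integrable Q).const_mul (c ^ 2)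
  have i12 : Integrable (fun p : Y × Y => f p.1 * f p.2 - c * (f p.1 * g p.2)) Q := i1.sub i2
  have i34 : Integrable (fun p : Y × Y => c * (g p.1 * f p.2) - c ^ 2 * (g p.1 * g p.2)) Q :=
    i3.sub i4
  simp_rw [e] at h0
  rw [← hQ, integral_sub i12 i34, integral_sub i1 i2, integral_sub i3 i4,
    integral_const_mul, integral_const_mul, integral_const_mul, hgf, ← hc] at h0
  nlinarith [sq_nonneg c]

theorem average_pow_le_average {a b : ℕ → ℝ} (k : ℕ) (h : ∀ n, a n ^ 2 ^ k ≤ b n) {N : ℕ}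
    (hN : 0 < N) :
    ((N : ℝ)⁻¹ * ∑ n ∈ Finset.range N, a n) ^ 2 ^ k ≤ (N : ℝ)⁻¹ * ∑ n ∈ Finset.range N, b n := by
  have hN' : (N : ℝ) ≠ 0 := by positivity
  have hpow : ((N : ℝ)⁻¹ * ∑ n ∈ Finset.range N, a n) ^ 2 ^ k ≤
      (N : ℝ)⁻¹ * ∑ n ∈ Finset.range N, a n ^ 2 ^ k := by
    -- Jensen's inequality for an even power; for `k = 0` the exponent is `1` and there is nothing
    -- to prove.
    rcases Nat.eq_zero_or_pos k with rfl | hk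
    · simp
    · rw [Finset.mul_sum, Finset.mul_sum]
      exact Real.pow_arith_mean_le_arith_mean_pow_of_even _ _ _ (fun _ _ => by positivity)
        (by simp [hN']) ((Nat.even_pow.2 ⟨even_two, hk.ne'⟩))
  refine hpow.trans ?_
  gcongr with n _
  exact h n

/-- The Gowers–Cauchy–Schwarz inequality, for functions bounded by `1`. -/
theorem integral_prod_pow_le {k : ℕ} {T : Fin k → X → X}
    (hT : ∀ i, MeasurePreserving (T i) μ μ) (hcomm : ∀ i j, Function.Commute (T i) (T j))
    {f : (Fin k → Bool) → X → ℝ} (hf : ∀ ε, BddMeas (f ε)) (hf1 : ∀ ε x, |f ε x| ≤ 1) :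
    (∫ x, ∏ ε, f ε (x ε) ∂(boxMeasure μ T)) ^ 2 ^ k ≤
      ∫ x, ∏ ε, f (zeroIndex k) (x ε) ∂(boxMeasure μ T) := by
  induction k with
  | zero =>
    simp only [pow_zero, pow_one]
    refine le_of_eq (integral_congr_ae (.of_forall fun x => Finset.prod_congr rfl fun ε _ => ?_))
    rw [Subsingleton.elim ε (zeroIndex 0)]
  | succ k ih =>
    have hS := measurePreserving_diag_last hT hcomm
    set ν := boxMeasure μ fun i => T i.castSucc with hν
    set S := diag k (T (Fin.last k)) with hSdef
    set g := f (zeroIndex (k + 1)) with hg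
    have hgz : f (Fin.snoc (zeroIndex k) false) = g := by
      rw [hg]
      congr 1
      funext i
      refine Fin.lastCases ?_ (fun i => ?_) i <;> simp [zeroIndex]
    rw [integral_boxMeasure_succ T hf, integral_boxMeasure_succ T (f := fun _ => g)
      fun _ => hf _]
    have hF0 : BddMeas fun y : (Fin k → Bool) → X => ∏ η, f (Fin.snoc η false) (y η) :=
      .prod_apply fun η => hf _
    have hF1 : BddMeas fun y : (Fin k → Bool) → X => ∏ η, f (Fin.snoc η true) (y η) :=
      .prod_apply fun η => hf _
    have hG : BddMeas fun y : (Fin k → Bool) → X => ∏ η, g (y η) := .prod_apply fun η => hf _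
    -- Cauchy–Schwarz in the last direction discards the functions at indices ending in `1`.
    have hCS := integral_condIndepSquare_sq_le ν S hF0 hF1 fun y => by
      rw [Finset.abs_prod]
      exact Finset.prod_le_one (fun _ _ => abs_nonneg _) fun η _ => hf1 _ _
    rw [pow_succ', pow_mul]
    refine (pow_le_pow_left₀ (sq_nonneg _) hCS _).trans ?_
    -- Both squares are limits of ergodic averages over the lower cube. Induction applies to each
    -- term, with `f_η ∘ T^n · f_η` as the functions, and Jensen carries the power through the
    -- average.
    refine le_of_tendsto_of_tendsto ((tendsto_average_condIndepSquare hS hF0 hF0).pow (2 ^ k))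
      (tendsto_average_condIndepSquare hS hG hG) ?_
    filter_upwards [eventually_gt_atTop 0] with N hN
    refine average_pow_le_average k (fun n => ?_) hN
    have hTn : Measurable (T (Fin.last k))^[n] := (hT _).measurable.iterate n
    have h := @ih (fun i => T i.castSucc) (fun i => hT _) (fun i j => hcomm _ _)
      (fun η x => f (Fin.snoc η false) ((T (Fin.last k))^[n] x) * f (Fin.snoc η false) x)
      (fun η => ((hf _).comp hTn).mul (hf _))
      (fun η x => by
        rw [abs_mul]
        exact mul_le_one₀ (hf1 _ _) (abs_nonneg _) (hf1 _ _))
    simp only [hgz, Finset.prod_mul_distrib] at h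
    simp only [hSdef, diag_iterate]
    exact h

/-- The last doubling turns the integral into that of a square. In dimension `0` it is `∫ f dμ`,
which can be negative. -/
theorem integral_prod_self_nonneg {k : ℕ} (T : Fin (k + 1) → X → X) {f : X → ℝ}
    (hf : BddMeas f) : 0 ≤ ∫ x, ∏ ε, f (x ε) ∂(boxMeasure μ T) := by
  rw [integral_boxMeasure_succ T (f := fun _ => f) fun _ => hf]
  exact integral_condIndepSquare_self_nonneg _ _ (.prod_apply fun _ => hf)

end Box

/-! ### The σ-algebra `Z` and orthogonality to functions of `x^♯` -/

section Characteristic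

/-- The action of a side transformation on `X^♯`. -/
def sideSharp {X : Type*} {d : ℕ} (T : Fin d → X → X) (i : Fin d) (y : Sharp d X) : Sharp d X :=
  fun ε => if ε.1 i then T i (y ε) else y ε

theorem sharp_side {X : Type*} {d : ℕ} (T : Fin d → X → X) (i : Fin d) (x : (Fin d → Bool) → X) :
    sharp (side T i x) = sideSharp T i (sharp x) :=
  rfl

theorem side_zeroIndex {X : Type*} {d : ℕ} (T : Fin d → X → X) (i : Fin d)
    (x : (Fin d → Bool) → X) : side T i x (zeroIndex d) = x (zeroIndex d) := by
  simp [side, zeroIndex]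

theorem measurable_sharp {X : Type*} [MeasurableSpace X] {d : ℕ} :
    Measurable (sharp : ((Fin d → Bool) → X) → Sharp d X) :=
  measurable_pi_lambda _ fun ε => measurable_pi_apply ε.1

theorem measurable_sideSharp {X : Type*} [MeasurableSpace X] {d : ℕ} {T : Fin d → X → X}
    {i : Fin d} (hT : Measurable (T i)) : Measurable (sideSharp T i) := by
  refine measurable_pi_lambda _ fun ε => ?_
  by_cases h : ε.1 i
  · simpa [sideSharp, h, Function.comp_def] using hT.comp (measurable_pi_apply ε)
  · simpa [sideSharp, h] using measurable_pi_apply ε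

variable {X : Type*} [MeasurableSpace X] [StandardBorelSpace X] {μ : Measure X}
  [IsProbabilityMeasure μ] {d : ℕ} {T : Fin d → X → X}

theorem integral_prod_eq_zero (hd : 1 ≤ d) (hT : ∀ i, MeasurePreserving (T i) μ μ)
    (hcomm : ∀ i j, Function.Commute (T i) (T j)) {f : (Fin d → Bool) → X → ℝ}
    (hf : ∀ ε, BddMeas (f ε))
    (h0 : ∫ x, ∏ ε, f (zeroIndex d) (x ε) ∂(boxMeasure μ T) = 0) :
    ∫ x, ∏ ε, f ε (x ε) ∂(boxMeasure μ T) = 0 := by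
  choose C hC using fun ε => (hf ε).bound
  -- A common bound for all the functions, kept positive by the `1` so that it can be divided out.
  set K : ℝ := 1 + ∑ ε, |C ε| with hK
  have hK0 : 0 < K := by positivity
  have hfK : ∀ ε x, |f ε x| ≤ K := fun ε x => by
    have := Finset.single_le_sum (f := fun ε => |C ε|) (fun ε _ => abs_nonneg _)
      (Finset.mem_univ ε)
    have h2 := (hC ε x).trans (le_abs_self _)
    linarith
  have h := integral_prod_pow_le (μ := μ) hT hcomm (f := fun ε x => K⁻¹ * f ε x)
    (fun ε => (BddMeas.const _).mul (hf ε)) (fun ε x => by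
      rw [abs_mul, abs_of_pos (inv_pos.2 hK0)]
      exact inv_mul_le_one_of_le₀ (hfK ε x) hK0.le)
  simp only [Finset.prod_mul_distrib, Finset.prod_const, integral_const_mul, h0, mul_zero] at h
  -- A nonpositive even power is zero; evenness is where `d ≥ 1` is needed.
  have heven : Even (2 ^ d) := Nat.even_pow.2 ⟨even_two, by omega⟩
  have h1 := pow_eq_zero_iff (by positivity) |>.1 (le_antisymm h (heven.pow_nonneg _))
  exact (mul_eq_zero.1 h1).resolve_left (by positivity)

theorem integral_prod_eq_zero_iff_forall_sharp (hd : 1 ≤ d)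
    (hT : ∀ i, MeasurePreserving (T i) μ μ) (hcomm : ∀ i j, Function.Commute (T i) (T j))
    {f : X → ℝ} (hf : BddMeas f) :
    ∫ x, ∏ ε, f (x ε) ∂(boxMeasure μ T) = 0 ↔ ∀ g : Sharp d X → ℝ, BddMeas g →
      ∫ x, f (x (zeroIndex d)) * g (sharp x) ∂(boxMeasure μ T) = 0 := by
  constructor
  · intro h0
    have hf0 := hf.comp (measurable_pi_apply (X := fun _ : Fin d → Bool => X) (zeroIndex d))
    obtain ⟨Φ, hΦ, hfΦ⟩ := exists_factor_condExp (boxMeasure μ T) (measurable_sharp (d := d)) hf0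
    have hmp : MeasurePreserving sharp (boxMeasure μ T) ((boxMeasure μ T).map sharp) :=
      ⟨measurable_sharp, rfl⟩
    have := Measure.isProbabilityMeasure_map (μ := boxMeasure μ T)
      (measurable_sharp (X := X) (d := d)).aemeasurable
    -- On a box, the integral of `Φ` is a cube integral with `f` at `∅` and indicators elsewhere,
    -- which vanishes by Gowers–Cauchy–Schwarz. Boxes generate the σ-algebra of `X^♯`.
    have hbox : ∀ t : {ε : Fin d → Bool // ε ≠ zeroIndex d} → Set X,
        (∀ ε, MeasurableSet (t ε)) →
        ∫ y in Set.univ.pi t, Φ y ∂((boxMeasure μ T).map sharp) = 0 := by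
      intro t ht
      have htm : MeasurableSet (Set.univ.pi t) := .univ_pi ht
      rw [← integral_mul_indicator_one htm,
        ← BddMeas.integral_comp hmp (hΦ.mul (.indicator_one htm)),
        ← hfΦ _ (.indicator_one htm)]
      let F : (Fin d → Bool) → X → ℝ := fun ε =>
        if h : ε ≠ zeroIndex d then (t ⟨ε, h⟩).indicator 1 else f
      have hF : ∀ ε, BddMeas (F ε) := fun ε => by
        by_cases h : ε = zeroIndex d
        · simpa [F, h] using hf
        · simpa [F, h] using BddMeas.indicator_one (ht ⟨ε, h⟩)
      have hF0 : F (zeroIndex d) = f := by simp [F]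
      have hz := integral_prod_eq_zero (μ := μ) hd hT hcomm hF (by rw [hF0]; exact h0)
      rw [← hz]
      refine integral_congr_ae (.of_forall fun x => ?_)
      simp only
      rw [Fintype.prod_eq_mul_prod_subtype_ne _ (zeroIndex d), hF0]
      congr 1
      have hFε : ∀ ε : {ε : Fin d → Bool // ε ≠ zeroIndex d},
          F ε.1 (x ε.1) = (t ε).indicator 1 (sharp x ε) := fun ε => by simp [F, ε.2, sharp]
      simp_rw [hFε]
      by_cases hx : sharp x ∈ Set.univ.pi t
      · rw [Set.indicator_of_mem hx, Finset.prod_eq_one fun ε _ => ?_, Pi.one_apply]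
        rw [Set.indicator_of_mem (hx ε trivial), Pi.one_apply]
      · rw [Set.indicator_of_notMem hx]
        simp only [Set.mem_univ_pi, not_forall] at hx
        obtain ⟨ε, hε⟩ := hx
        exact (Finset.prod_eq_zero (Finset.mem_univ ε) (Set.indicator_of_notMem hε _)).symm
    have hzero : Φ =ᵐ[(boxMeasure μ T).map sharp] 0 := by
      refine ae_eq_zero_of_forall_setIntegral_eq_of_sigmaFinite
        (fun s _ _ => (hΦ.integrable _).integrableOn) fun s hs _ => ?_
      refine setIntegral_eq_zero_of_generateFrom isPiSystem_pi generateFrom_pi.symm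
        (hΦ.integrable _) ?_ ?_ hs
      · simpa using hbox (fun _ => Set.univ) fun _ => .univ
      · rintro _ ⟨t, ht, rfl⟩
        exact hbox t fun ε => ht ε trivial
    intro g hg
    rw [hfΦ g hg]
    refine integral_eq_zero_of_ae ?_
    filter_upwards [hmp.quasiMeasurePreserving.ae hzero] with x hx
    simp [hx]
  · intro h
    -- The test function is the product of `f` over all coordinates other than `∅`.
    rw [← h (fun y => ∏ ε, f (y ε)) (.prod _ fun ε _ => hf.comp (measurable_pi_apply ε))]
    refine integral_congr_ae (.of_forall fun x => ?_)
    exact Fintype.prod_eq_mul_prod_subtype_ne _ (zeroIndex d)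

theorem sigmaZ_le (μ : Measure X) [IsProbabilityMeasure μ] (T : Fin d → X → X) :
    sigmaZ μ T ≤ ‹MeasurableSpace X› :=
  fun _ h => h.1

/-- For `B` in `Z` the set integral of `f` over `B` lifts to the cube, where `1_B(x_∅)` becomes an
admissible test function `1_A(x^♯)`. -/
theorem condExp_sigmaZ_eq_zero {f : X → ℝ} (hf : BddMeas f)
    (h : ∀ g : Sharp d X → ℝ, BddMeas g →
      ∫ x, f (x (zeroIndex d)) * g (sharp x) ∂(boxMeasure μ T) = 0) :
    μ[f | sigmaZ μ T] =ᵐ[μ] 0 := by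
  refine (ae_eq_condExp_of_forall_setIntegral_eq (sigmaZ_le μ T) (hf.integrable μ)
    (fun s _ _ => (integrable_zero X ℝ μ).integrableOn) (fun B hB _ => ?_)
    aestronglyMeasurable_zero).symm
  obtain ⟨hBm, A, hA, hBA⟩ := hB
  rw [← integral_mul_indicator_one (D := f) hBm, ← BddMeas.integral_comp
    (measurePreserving_apply μ T (zeroIndex d)) (hf.mul (.indicator_one hBm))]
  simp only [Pi.zero_apply, integral_zero]
  rw [← h _ (.indicator_one hA)]
  refine integral_congr_ae ?_
  filter_upwards [hBA] with x hx
  rw [hx]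

theorem integral_sharp_eq_zero (hT : ∀ i, MeasurePreserving (T i) μ μ)
    (hcomm : ∀ i j, Function.Commute (T i) (T j)) {f : X → ℝ} (hf : BddMeas f)
    (h : μ[f | sigmaZ μ T] =ᵐ[μ] 0) {g : Sharp d X → ℝ} (hg : BddMeas g) :
    ∫ x, f (x (zeroIndex d)) * g (sharp x) ∂(boxMeasure μ T) = 0 := by
  have hf0 := hf.comp (measurable_pi_apply (X := fun _ : Fin d → Bool => X) (zeroIndex d))
  obtain ⟨Φ, hΦ, hfΦ⟩ := exists_factor_condExp (boxMeasure μ T) (measurable_sharp (d := d)) hf0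
  have hmp : MeasurePreserving sharp (boxMeasure μ T) ((boxMeasure μ T).map sharp) :=
    ⟨measurable_sharp, rfl⟩
  have := Measure.isProbabilityMeasure_map (μ := boxMeasure μ T)
    (measurable_sharp (X := X) (d := d)).aemeasurable
  have hΦs := hΦ.comp (measurable_sharp (X := X) (d := d))
  have hinv : ∀ i, ∀ᵐ x ∂(boxMeasure μ T), Φ (sharp (side T i x)) = Φ (sharp x) := by
    intro i
    have hside := measurePreserving_side hT hcomm i
    have hsm : Measurable (sideSharp T i) := measurable_sideSharp (hT i).measurable
    have hsharp : MeasurePreserving (sideSharp T i) ((boxMeasure μ T).map sharp)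
        ((boxMeasure μ T).map sharp) := by
      refine ⟨hsm, ?_⟩
      rw [Measure.map_map hsm measurable_sharp]
      exact (hmp.comp hside).map_eq
    -- Correlations of `Φ` with functions of `x^♯` equal those of `f(x_∅)`, and a side
    -- transformation preserves `μ^*` and leaves `x_∅` alone.
    refine hmp.quasiMeasurePreserving.ae (ae_invariant_of_integral_comp hsharp hΦ fun u hu => ?_)
    have hus := hu.comp hsm
    rw [← BddMeas.integral_comp hmp (hΦ.mul hus), ← BddMeas.integral_comp hmp (hΦ.mul hu),
      ← hfΦ _ hus, ← hfΦ _ hu,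
      ← BddMeas.integral_comp hside (hf0.mul (hu.comp measurable_sharp))]
    simp_rw [side_zeroIndex, sharp_side]
  obtain ⟨G, hG, hΦG⟩ := exists_eq_zeroIndex_of_side_invariant hT hcomm hΦs hinv
  -- The preimages of `s` under `G` and `Φ` are a pair `B`, `A` as in the definition of `Z`.
  have hGZ : Measurable[sigmaZ μ T] G := by
    intro s hs
    refine ⟨hG.measurable hs, Φ ⁻¹' s, hΦ.measurable hs, ?_⟩
    rw [agreesWith_iff]
    filter_upwards [hΦG] with x hx
    rw [Set.mem_preimage, Set.mem_preimage, hx]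
  have hsq : ∫ x, Φ (sharp x) * Φ (sharp x) ∂(boxMeasure μ T) = 0 := by
    calc _ = ∫ x, f (x (zeroIndex d)) * Φ (sharp x) ∂(boxMeasure μ T) := (hfΦ Φ hΦ).symm
      _ = ∫ x, f (x (zeroIndex d)) * G (x (zeroIndex d)) ∂(boxMeasure μ T) :=
        integral_congr_ae (by filter_upwards [hΦG] with x hx; rw [hx])
      _ = ∫ x, f x * G x ∂μ :=
        BddMeas.integral_comp (measurePreserving_apply μ T (zeroIndex d)) (hf.mul hG)
      _ = ∫ x, (μ[f | sigmaZ μ T]) x * G x ∂μ :=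
        (integral_condExp_mul (sigmaZ_le μ T) (hf.integrable μ)
          hGZ.stronglyMeasurable.aestronglyMeasurable ((hf.mul hG).integrable μ)).symm
      _ = 0 := integral_eq_zero_of_ae (by filter_upwards [h] with x hx; simp [hx])
  rw [integral_eq_zero_iff_of_nonneg (fun y => mul_self_nonneg _)
    ((hΦs.mul hΦs).integrable _)] at hsq
  rw [hfΦ g hg]
  refine integral_eq_zero_of_ae ?_
  filter_upwards [hsq] with x hx
  have hx' : Φ (sharp x) = 0 := mul_self_eq_zero.1 hx
  simp [hx']

theorem exists_bddMeas_ae_eq {Ω : Type*} [MeasurableSpace Ω] {P : Measure Ω} {f : Ω → ℝ}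
    (hf : MemLp f ∞ P) : ∃ g, BddMeas g ∧ f =ᵐ[P] g := by
  refine ⟨_, .clamp hf.1.stronglyMeasurable_mk.measurable (lpNorm f ∞ P), ?_⟩
  filter_upwards [hf.1.ae_eq_mk, ae_le_lpNorm_exponent_top hf] with x h1 h2
  rw [← h1, clamp_eq_self h2]

end Characteristic

end BoxSeminorm

/-! ### The characteristic σ-algebra theorem -/

theorem lemma2p7 {X : Type*} [MeasurableSpace X] [StandardBorelSpace X]
    (μ : Measure X) [IsProbabilityMeasure μ] {d : ℕ} (hd : 1 ≤ d)
    (T : Fin d → X → X) (hT : ∀ i, MeasurePreserving (T i) μ μ)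
    (hcomm : ∀ i j, Function.Commute (T i) (T j))
    (f : X → ℝ) (hf : MemLp f ∞ μ) :
    BoxSeminorm.boxSeminorm μ T f = 0 ↔
      μ[f | BoxSeminorm.sigmaZ μ T] =ᵐ[μ] 0 := by
  open BoxSeminorm in
  obtain ⟨g, hg, hfg⟩ := exists_bddMeas_ae_eq hf
  -- All one-coordinate marginals of `μ^*` are `μ`, so changing `f` on a null set does not affect
  -- the cube integral.
  have hint : ∫ x, ∏ ε : Fin d → Bool, f (x ε) ∂(boxMeasure μ T) =
      ∫ x, ∏ ε, g (x ε) ∂(boxMeasure μ T) := by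
    refine integral_congr_ae ?_
    filter_upwards [ae_all_iff.2 fun ε =>
      (measurePreserving_apply μ T ε).quasiMeasurePreserving.ae hfg] with x hx
    exact Finset.prod_congr rfl fun ε _ => hx ε
  -- Nonnegativity makes the real power vanish exactly when the integral does.
  have hnonneg : 0 ≤ ∫ x, ∏ ε, g (x ε) ∂(boxMeasure μ T) := by
    obtain ⟨k, rfl⟩ : ∃ k, d = k + 1 := ⟨d - 1, by omega⟩
    exact integral_prod_self_nonneg T hg
  have hcond : μ[f | sigmaZ μ T] =ᵐ[μ] 0 ↔ μ[g | sigmaZ μ T] =ᵐ[μ] 0 :=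
    ⟨(condExp_congr_ae hfg).symm.trans, (condExp_congr_ae hfg).trans⟩
  rw [hcond, boxSeminorm, hint, Real.rpow_eq_zero hnonneg (by positivity),
    integral_prod_eq_zero_iff_forall_sharp hd hT hcomm hg]
  exact ⟨condExp_sigmaZ_eq_zero hg, fun h u hu => integral_sharp_eq_zero hT hcomm hg h hu⟩
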